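/- Let $G$ be a connected graph with at least one vertex, possibly infinite, in which loops and multiple edges are allowed. Regard $G$ as a metric graph in which every edge has length $1$: its points are the vertices and the points in the interiors of edges, and the distance between two points is the length of a shortest path joining them. Let $e$ be a cut-edge of $G$, that is, an edge of $G$ such that the graph $G\setminus e$ obtained by deleting $e$ and keeping all vertices is not connected. Let $G/e$ be the graph obtained from $G$ by removing $e$ and merging its two endpoints into one vertex, all other edges being kept. Then $$\delta(G/e)=\delta(G).$$ Here, for a geodesic metric space $X$, $\delta(X)\in[0,\infty]$ is the sharp hyperbolicity constant $\delta(X)=\sup_T\delta(T)$, where $T$ ranges over all geodesic triangles in $X$ (three points, not necessarily distinct, together with a geodesic joining each pair of them), and $\delta(T)$ is the infimum of all $\delta\ge 0$ such that each side of $T$ is contained in the $\delta$-neighborhood of the union of the other two sides. -/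

import Mathlib

open scoped NNReal ENNReal

section Hyperbolicity

variable {X : Type*} [EMetricSpace X]

/-- `S` is (the image of) a geodesic from `x` to `y`, parametrized by arc length on `[0, ℓ]`. -/
def IsGeodesicSegment (S : Set X) (x y : X) : Prop :=
  ∃ (l : ℝ) (γ : ℝ → X), 0 ≤ l ∧ γ 0 = x ∧ γ l = y ∧ S = γ '' Set.Icc 0 l ∧
    ∀ s ∈ Set.Icc 0 l, ∀ t ∈ Set.Icc 0 l, edist (γ s) (γ t) = ENNReal.ofReal |s - t|

/-- A geodesic triangle `{[x₁x₂], [x₂x₃], [x₃x₁]}`. The vertices need not be distinct, and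
the sides are arbitrary geodesics between them. -/
structure GeodesicTriangle (X : Type*) [EMetricSpace X] where
  x₁ : X
  x₂ : X
  x₃ : X
  side₁₂ : Set X
  side₂₃ : Set X
  side₃₁ : Set X
  isGeodesic₁₂ : IsGeodesicSegment side₁₂ x₁ x₂
  isGeodesic₂₃ : IsGeodesicSegment side₂₃ x₂ x₃
  isGeodesic₃₁ : IsGeodesicSegment side₃₁ x₃ x₁

/-- `S` lies in the `δ`-neighborhood of `S'`. -/
def WithinNeighborhood (δ : ℝ≥0) (S S' : Set X) : Prop :=
  ∀ p ∈ S, ∃ q ∈ S', edist p q ≤ δ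

namespace GeodesicTriangle

/-- The triangle is `δ`-thin: each side lies in the `δ`-neighborhood of the union of the
two other sides. -/
def IsThin (T : GeodesicTriangle X) (δ : ℝ≥0) : Prop :=
  WithinNeighborhood δ T.side₁₂ (T.side₂₃ ∪ T.side₃₁) ∧
  WithinNeighborhood δ T.side₂₃ (T.side₃₁ ∪ T.side₁₂) ∧
  WithinNeighborhood δ T.side₃₁ (T.side₁₂ ∪ T.side₂₃)

/-- The sharp thin constant `δ(T)`. -/
noncomputable def thinConstant (T : GeodesicTriangle X) : ℝ≥0∞ :=
  ⨅ (δ : ℝ≥0) (_ : T.IsThin δ), (δ : ℝ≥0∞)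

end GeodesicTriangle

/-- The sharp hyperbolicity constant `δ(X) ∈ [0, ∞]`: the supremum of `δ(T)` over all geodesic
triangles `T` in `X`. -/
noncomputable def hyperbolicityConstant (X : Type*) [EMetricSpace X] : ℝ≥0∞ :=
  ⨆ T : GeodesicTriangle X, T.thinConstant

end Hyperbolicity

/-! Mathlib's `Graph α β` is the type of multigraphs, in which loops and multiple edges are
allowed. -/

namespace Graph

variable {α β : Type*}

/-- `G` has a vertex, and any two vertices are joined by a path. Neither connectedness
nor the distance between vertices is affected by the loops and the multiplicities of edges, which
the underlying simple graph forgets. -/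
def IsConnected (G : Graph α β) : Prop :=
  G.toSimpleGraph.Connected

/-- `e` is an edge of `G` and `G \ e` is not connected. -/
def IsCutEdge (G : Graph α β) (e : β) : Prop :=
  e ∈ G.edgeSet ∧ ¬ (G.deleteEdges {e}).IsConnected

/-- The contraction `G / e`: the edge `e` is removed and its two ends are merged. All other edges
are kept, so that parallel edges and loops may arise. -/
def contractEdge (G : Graph α β) (e : β) : Graph (Quot (G.IsLink e)) β :=
  (G.deleteEdges {e}).map (Quot.mk (G.IsLink e))

/-- The points of `G` seen as a metric graph: the vertices, and the points in the interior of
an edge. -/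
inductive Point (G : Graph α β) where
  | vertex (v : G.vertexSet)
  | inner (e : G.edgeSet) (t : Set.Ioo (0 : ℝ) 1)

/-- The end of the edge `e` at parameter `0`; which of the two ends this is, is an arbitrary
choice. -/
noncomputable def src (G : Graph α β) (e : G.edgeSet) : G.vertexSet :=
  ⟨(exists_isLink_of_mem_edgeSet e.2).choose,
    (exists_isLink_of_mem_edgeSet e.2).choose_spec.choose_spec.left_mem⟩

/-- The other end of the edge `e`, at parameter `1` (equal to `G.src e` when `e` is a loop). -/
noncomputable def tgt (G : Graph α β) (e : G.edgeSet) : G.vertexSet :=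
  ⟨(exists_isLink_of_mem_edgeSet e.2).choose_spec.choose,
    (exists_isLink_of_mem_edgeSet e.2).choose_spec.choose_spec.right_mem⟩

lemma isLink_src_tgt (G : Graph α β) (e : G.edgeSet) : G.IsLink e (G.src e) (G.tgt e) :=
  (exists_isLink_of_mem_edgeSet e.2).choose_spec.choose_spec

/-- The least number of edges of a path from `u` to `v` (infinite if there is none). -/
noncomputable def vertexDist (G : Graph α β) (u v : G.vertexSet) : ℝ≥0∞ :=
  (G.toSimpleGraph.edist u v : ℝ≥0∞)

namespace Point

variable {G : Graph α β}

/-- The length of a shortest path from a point to a vertex: from the interior of an edge such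
a path leaves through one of the two ends. -/
noncomputable def toVertex : G.Point → G.vertexSet → ℝ≥0∞
  | vertex u, v => G.vertexDist u v
  | inner e t, v => min (ENNReal.ofReal t + G.vertexDist (G.src e) v)
      (ENNReal.ofReal (1 - t) + G.vertexDist (G.tgt e) v)

open Classical in
/-- The length of the path between two points which stays in the interior of one edge
(infinite if there is none). -/
noncomputable def alongEdge : G.Point → G.Point → ℝ≥0∞
  | inner e s, inner f t => if e = f then ENNReal.ofReal |(s : ℝ) - t| else ⊤
  | _, _ => ⊤

/-- The length of a shortest path between two points, every edge having length `1`: a path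
either stays in the interior of one edge or passes through some vertex `v`. -/
noncomputable def pathDist (p q : G.Point) : ℝ≥0∞ :=
  min (alongEdge p q) (⨅ v, toVertex p v + toVertex q v)

lemma vertexDist_self (u : G.vertexSet) : G.vertexDist u u = 0 := by
  simp [vertexDist]

lemma vertexDist_comm (u v : G.vertexSet) : G.vertexDist u v = G.vertexDist v u := by
  simp [vertexDist, SimpleGraph.edist_comm]

lemma vertexDist_triangle (u v w : G.vertexSet) :
    G.vertexDist u w ≤ G.vertexDist u v + G.vertexDist v w := by
  unfold vertexDist
  exact_mod_cast G.toSimpleGraph.edist_triangle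

lemma eq_of_vertexDist_eq_zero {u v : G.vertexSet} (h : G.vertexDist u v = 0) : u = v := by
  simpa [vertexDist] using h

lemma vertexDist_src_tgt (e : G.edgeSet) : G.vertexDist (G.src e) (G.tgt e) ≤ 1 := by
  by_cases h : G.src e = G.tgt e
  · simp [h, vertexDist_self]
  · have : G.toSimpleGraph.Adj (G.src e) (G.tgt e) := ⟨h, e, G.isLink_src_tgt e⟩
    simp [vertexDist, SimpleGraph.edist_eq_one_iff_adj.2 this]

lemma toVertex_le (p : G.Point) (v w : G.vertexSet) :
    toVertex p w ≤ toVertex p v + G.vertexDist v w := by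
  cases p with
  | vertex u => exact vertexDist_triangle u v w
  | inner e t =>
    simp only [toVertex, ← min_add_add_right, add_assoc]
    exact min_le_min (by gcongr; exact vertexDist_triangle _ _ _)
      (by gcongr; exact vertexDist_triangle _ _ _)

lemma vertexDist_le_toVertex (q : G.Point) (v w : G.vertexSet) :
    G.vertexDist v w ≤ toVertex q v + toVertex q w := by
  cases q with
  | vertex u =>
    simpa [toVertex, vertexDist_comm u v] using vertexDist_triangle v u w
  | inner e t =>
    obtain ⟨t, ht0, ht1⟩ := t
    have hone : ENNReal.ofReal t + ENNReal.ofReal (1 - t) = 1 := by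
      rw [← ENNReal.ofReal_add ht0.le (by linarith)]; simp
    have h1 := fun a b : G.vertexSet => vertexDist_triangle a (G.src e) b
    have h2 := fun a b : G.vertexSet => vertexDist_triangle a (G.tgt e) b
    have key : ∀ a b : G.vertexSet, G.vertexDist a b ≤
        (ENNReal.ofReal t + G.vertexDist (G.src e) a) +
          (ENNReal.ofReal (1 - t) + G.vertexDist (G.tgt e) b) := by
      intro a b
      calc G.vertexDist a b ≤ G.vertexDist a (G.src e) + G.vertexDist (G.src e) b := h1 a b
        _ ≤ G.vertexDist (G.src e) a + (1 + G.vertexDist (G.tgt e) b) := by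
            rw [vertexDist_comm a]
            gcongr
            exact (h2 _ _).trans (by gcongr; exact vertexDist_src_tgt e)
        _ = _ := by rw [← hone]; ring
    simp only [toVertex]
    rcases min_choice (ENNReal.ofReal t + G.vertexDist (G.src e) v)
        (ENNReal.ofReal (1 - t) + G.vertexDist (G.tgt e) v) with h | h <;>
      rcases min_choice (ENNReal.ofReal t + G.vertexDist (G.src e) w)
        (ENNReal.ofReal (1 - t) + G.vertexDist (G.tgt e) w) with h' | h' <;>
      rw [h, h']
    · refine (h1 v w).trans ?_
      rw [vertexDist_comm v]
      exact add_le_add le_add_self le_add_self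
    · exact key v w
    · rw [vertexDist_comm, add_comm]
      exact key w v
    · refine (h2 v w).trans ?_
      rw [vertexDist_comm v]
      exact add_le_add le_add_self le_add_self

lemma alongEdge_comm (p q : G.Point) : alongEdge p q = alongEdge q p := by
  cases p <;> cases q <;> try rfl
  simp only [alongEdge, abs_sub_comm, eq_comm]
  congr 1
  exact propext eq_comm

lemma toVertex_le_alongEdge (p q : G.Point) (v : G.vertexSet) :
    toVertex p v ≤ alongEdge p q + toVertex q v := by
  cases p with
  | vertex u => simp [alongEdge]
  | inner e s =>
    cases q with
    | vertex u => simp [alongEdge]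
    | inner f t =>
      by_cases hef : e = f
      · subst hef
        obtain ⟨s, hs0, hs1⟩ := s
        obtain ⟨t, ht0, ht1⟩ := t
        simp only [alongEdge, if_true, toVertex, ← min_add_add_left, ← add_assoc]
        refine min_le_min ?_ ?_ <;> gcongr <;>
          rw [← ENNReal.ofReal_add (abs_nonneg _) (by linarith)] <;>
          apply ENNReal.ofReal_le_ofReal
        · linarith [le_abs_self (s - t)]
        · linarith [neg_abs_le (s - t)]
      · simp [alongEdge, hef]

lemma alongEdge_triangle (p q r : G.Point) :
    alongEdge p r ≤ alongEdge p q + alongEdge q r := by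
  cases p with
  | vertex u => simp [alongEdge]
  | inner e s =>
    cases q with
    | vertex u => simp [alongEdge]
    | inner f t =>
      cases r with
      | vertex u => simp [alongEdge]
      | inner g x =>
        by_cases h1 : e = f
        · by_cases h2 : f = g
          · subst h1 h2
            simp only [alongEdge, if_true]
            rw [← ENNReal.ofReal_add (abs_nonneg _) (abs_nonneg _)]
            exact ENNReal.ofReal_le_ofReal (abs_sub_le _ _ _)
          · simp [alongEdge, h2]
        · simp [alongEdge, h1]

lemma pathDist_self (p : G.Point) : pathDist p p = 0 := by
  cases p with
  | vertex u =>
    refine le_antisymm ((min_le_right _ _).trans ((iInf_le _ u).trans ?_)) bot_le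
    simp [toVertex, vertexDist_self]
  | inner e t => simp [pathDist, alongEdge]

lemma pathDist_comm (p q : G.Point) : pathDist p q = pathDist q p := by
  simp only [pathDist, alongEdge_comm p q, add_comm (toVertex p _)]

lemma pathDist_triangle (p q r : G.Point) : pathDist p r ≤ pathDist p q + pathDist q r := by
  unfold pathDist
  rw [← min_add_add_right, ← min_add_add_left, ← min_add_add_left]
  refine le_min (le_min ?_ ?_) (le_min ?_ ?_)
  · exact (min_le_left _ _).trans (alongEdge_triangle p q r)
  · rw [ENNReal.add_iInf]
    refine le_iInf fun v => (min_le_right _ _).trans ((iInf_le _ v).trans ?_)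
    rw [← add_assoc]
    gcongr
    exact toVertex_le_alongEdge p q v
  · rw [ENNReal.iInf_add]
    refine le_iInf fun v => (min_le_right _ _).trans ((iInf_le _ v).trans ?_)
    rw [add_assoc]
    gcongr
    rw [add_comm, alongEdge_comm]
    exact toVertex_le_alongEdge r q v
  · rw [ENNReal.iInf_add]
    refine le_iInf fun v => ?_
    rw [ENNReal.add_iInf]
    refine le_iInf fun w => (min_le_right _ _).trans ((iInf_le _ w).trans ?_)
    calc toVertex p w + toVertex r w
        ≤ toVertex p v + (toVertex q v + toVertex q w) + toVertex r w := by
          gcongr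
          exact (toVertex_le p v w).trans (by gcongr; exact vertexDist_le_toVertex q v w)
      _ = _ := by ring

/-- A lower bound for the distance of a point to the vertices. -/
lemma le_toVertex_inner (e : G.edgeSet) (t : Set.Ioo (0 : ℝ) 1) (v : G.vertexSet) :
    ENNReal.ofReal (min (t : ℝ) (1 - t)) ≤ toVertex (inner e t) v :=
  le_min ((ENNReal.ofReal_le_ofReal (min_le_left _ _)).trans le_self_add)
    ((ENNReal.ofReal_le_ofReal (min_le_right _ _)).trans le_self_add)

lemma pathDist_inner_pos_of_top (e : G.edgeSet) (t : Set.Ioo (0 : ℝ) 1) (q : G.Point)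
    (h : alongEdge (inner e t) q ≠ 0) : pathDist (inner e t) q ≠ 0 := by
  have hpos : 0 < ENNReal.ofReal (min (t : ℝ) (1 - t)) := by
    have := t.2.1; have := t.2.2
    exact ENNReal.ofReal_pos.2 (lt_min (by assumption) (by linarith))
  refine (lt_min (pos_iff_ne_zero.2 h) (hpos.trans_le (le_iInf fun v => ?_))).ne'
  exact (le_toVertex_inner e t v).trans le_self_add

lemma eq_of_pathDist_eq_zero {p q : G.Point} (h : pathDist p q = 0) : p = q := by
  cases p with
  | vertex u =>
    cases q with
    | vertex v =>
      have h' : G.vertexDist u v ≤ pathDist (vertex u) (vertex v) := by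
        refine le_min (by simp [alongEdge]) (le_iInf fun w => ?_)
        simpa [toVertex, vertexDist_comm w v] using vertexDist_triangle u w v
      rw [h] at h'
      rw [eq_of_vertexDist_eq_zero (le_antisymm h' bot_le)]
    | inner f t =>
      rw [pathDist_comm] at h
      exact absurd h (pathDist_inner_pos_of_top f t _ (by simp [alongEdge]))
  | inner e s =>
    by_contra hne
    refine pathDist_inner_pos_of_top e s q ?_ h
    cases q with
    | vertex v => simp [alongEdge]
    | inner f t =>
      by_cases hef : e = f
      · subst hef
        have hst : (s : ℝ) ≠ t := fun hst => hne (by rw [Subtype.ext hst])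
        simpa [alongEdge, sub_eq_zero] using hst
      · simp [alongEdge, hef]

/-- `G` as a metric graph. The distance is finite when `G` is connected. -/
noncomputable instance : EMetricSpace G.Point where
  edist := pathDist
  edist_self := pathDist_self
  edist_comm := pathDist_comm
  edist_triangle := pathDist_triangle
  eq_of_edist_eq_zero := eq_of_pathDist_eq_zero

end Point

end Graph

/-! Write o for the vertex of G/e to which e is contracted. G arises from G/e by cutting at o and
inserting a segment of length 1 between the two sides. Let f : G → G/e be the collapse and h the
height: the parameter along e, continued by the constants 0 and 1 on the two components of G \ e.
Then d(p, q) = d(f p, f q) + |h p - h q|, and if h p ≠ h q, then d(f p, f q) = d(f p, o) + d(o, f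
q). `IsBridgeCollapse` isolates these properties, and the equality of the two constants follows from
them alone.

By the distance formula f and h are both additive along geodesics, so f maps geodesics to geodesics.
Conversely a geodesic of G/e lifts to a geodesic between any chosen lifts of its ends: where the
heights differ it passes through o, and the missing piece of the bridge is inserted there. Since f
is 1-Lipschitz, lifting triangles gives δ(G/e) ≤ δ(G). For the other inequality, project a triangle
of G. If f p is δ-close to f q with h p ≠ h q, then f p is δ-close to o as well, and the other two
sides contain the bridge point of height h p, whose distance to p is d(f p, o).

The distance formula `edist_eq` rests on the maximality of the graph distance, `Point.le_edist`. It
is applied on G to d(f p, f q) + |h p - h q|, and on G/e to the sum of the distances between the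
retractions to the two sides. -/

section Geodesic

/-! ### Geodesic segments in metric spaces -/

variable {X : Type*} [MetricSpace X] {S : Set X} {x y : X}

lemma isGeodesicSegment_iff_exists_dist : IsGeodesicSegment S x y ↔
    ∃ (l : ℝ) (γ : ℝ → X), 0 ≤ l ∧ γ 0 = x ∧ γ l = y ∧ S = γ '' Set.Icc 0 l ∧
      ∀ s ∈ Set.Icc 0 l, ∀ t ∈ Set.Icc 0 l, dist (γ s) (γ t) = |s - t| := by
  simp only [IsGeodesicSegment, edist_dist]
  simp_rw [ENNReal.ofReal_eq_ofReal_iff dist_nonneg (abs_nonneg _)]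

/-- A set is a geodesic segment as soon as some coordinate identifies it with an interval. -/
lemma isGeodesicSegment_of_coordinate (u : X → ℝ) (hx : x ∈ S) (hy : y ∈ S) (h0 : u x = 0)
    (himg : u '' S = Set.Icc 0 (u y)) (hu : ∀ p ∈ S, ∀ q ∈ S, dist p q = |u p - u q|) :
    IsGeodesicSegment S x y := by
  -- `γ` is to invert `u` on `[0, u y]`; its values elsewhere are irrelevant, so the membership of
  -- `t` sits inside the existential.
  have hex : ∀ t, ∃ p, t ∈ Set.Icc 0 (u y) → p ∈ S ∧ u p = t := by
    intro t
    by_cases ht : t ∈ Set.Icc 0 (u y)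
    · obtain ⟨p, hp, hpt⟩ := himg.symm.subset ht
      exact ⟨p, fun _ => ⟨hp, hpt⟩⟩
    · exact ⟨x, fun h => absurd h ht⟩
  choose γ hγ using hex
  have hinj : ∀ p ∈ S, ∀ q ∈ S, u p = u q → p = q := fun p hp q hq h =>
    dist_eq_zero.1 (by rw [hu p hp q hq, h, sub_self, abs_zero])
  have hmem : ∀ p ∈ S, u p ∈ Set.Icc 0 (u y) := fun p hp => himg.subset ⟨p, hp, rfl⟩
  have hγu : ∀ p ∈ S, γ (u p) = p := fun p hp =>
    hinj _ (hγ _ (hmem p hp)).1 _ hp (hγ _ (hmem p hp)).2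
  refine isGeodesicSegment_iff_exists_dist.2 ⟨u y, γ, (hmem y hy).1, ?_, hγu y hy, ?_, ?_⟩
  · rw [← h0]; exact hγu x hx
  · ext p
    constructor
    · exact fun hp => ⟨u p, hmem p hp, hγu p hp⟩
    · rintro ⟨t, ht, rfl⟩
      exact (hγ t ht).1
  · intro s hs t ht
    rw [hu _ (hγ s hs).1 _ (hγ t ht).1, (hγ s hs).2, (hγ t ht).2]

namespace IsGeodesicSegment

lemma left_mem (hS : IsGeodesicSegment S x y) : x ∈ S := by
  obtain ⟨l, γ, hl, rfl, rfl, rfl, -⟩ := hS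
  exact ⟨0, ⟨le_rfl, hl⟩, rfl⟩

lemma symm (hS : IsGeodesicSegment S x y) : IsGeodesicSegment S y x := by
  obtain ⟨l, γ, hl, rfl, rfl, rfl, hγ⟩ := hS
  refine ⟨l, fun t => γ (l - t), hl, by simp, by simp, ?_, ?_⟩
  · ext p
    constructor
    · rintro ⟨t, ht, rfl⟩
      exact ⟨l - t, ⟨by linarith [ht.2], by linarith [ht.1]⟩, by simp⟩
    · rintro ⟨t, ht, rfl⟩
      exact ⟨l - t, ⟨by linarith [ht.2], by linarith [ht.1]⟩, rfl⟩
  · intro s hs t ht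
    rw [hγ _ ⟨by linarith [hs.2], by linarith [hs.1]⟩ _ ⟨by linarith [ht.2], by linarith [ht.1]⟩,
      abs_sub_comm]
    congr 2
    ring

lemma right_mem (hS : IsGeodesicSegment S x y) : y ∈ S := hS.symm.left_mem

lemma dist_add_dist (hS : IsGeodesicSegment S x y) {p : X} (hp : p ∈ S) :
    dist x p + dist p y = dist x y := by
  obtain ⟨l, γ, hl, rfl, rfl, rfl, hγ⟩ := isGeodesicSegment_iff_exists_dist.1 hS
  obtain ⟨s, hs, rfl⟩ := hp
  have h0 : (0 : ℝ) ∈ Set.Icc 0 l := ⟨le_rfl, hl⟩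
  have h1 : l ∈ Set.Icc 0 l := ⟨hl, le_rfl⟩
  rw [hγ _ h0 _ hs, hγ _ hs _ h1, hγ _ h0 _ h1, zero_sub, zero_sub, abs_neg, abs_neg,
    abs_of_nonneg hs.1, abs_of_nonneg hl, abs_of_nonpos (by linarith [hs.2])]
  ring

lemma dist_eq_abs (hS : IsGeodesicSegment S x y) {p q : X} (hp : p ∈ S) (hq : q ∈ S) :
    dist p q = |dist x p - dist x q| := by
  obtain ⟨l, γ, hl, rfl, rfl, rfl, hγ⟩ := isGeodesicSegment_iff_exists_dist.1 hS
  obtain ⟨s, hs, rfl⟩ := hp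
  obtain ⟨t, ht, rfl⟩ := hq
  have h0 : (0 : ℝ) ∈ Set.Icc 0 l := ⟨le_rfl, hl⟩
  rw [hγ _ hs _ ht, hγ _ h0 _ hs, hγ _ h0 _ ht, zero_sub, zero_sub, abs_neg, abs_neg,
    abs_of_nonneg hs.1, abs_of_nonneg ht.1]

/-- Between two points of a geodesic segment there are points at all distances. -/
lemma exists_between (hS : IsGeodesicSegment S x y) {z w : X} (hz : z ∈ S) (hw : w ∈ S)
    {r : ℝ} (hr : r ∈ Set.Icc 0 (dist z w)) :
    ∃ q ∈ S, dist z q = r ∧ dist q w = dist z w - r := by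
  obtain ⟨l, γ, hl, rfl, rfl, rfl, hγ⟩ := isGeodesicSegment_iff_exists_dist.1 hS
  obtain ⟨s, hs, rfl⟩ := hz
  obtain ⟨t, ht, rfl⟩ := hw
  obtain ⟨hr0, hr1⟩ := hr
  rw [hγ _ hs _ ht] at hr1 ⊢
  obtain ⟨hs0, hs1⟩ := hs
  obtain ⟨ht0, ht1⟩ := ht
  rcases le_total s t with hst | hst
  · rw [abs_of_nonpos (by linarith)] at hr1 ⊢
    have hm : s + r ∈ Set.Icc 0 l := ⟨by linarith, by linarith⟩
    refine ⟨γ (s + r), ⟨_, hm, rfl⟩, ?_, ?_⟩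
    · rw [hγ _ ⟨hs0, hs1⟩ _ hm, abs_of_nonpos (by linarith)]; ring
    · rw [hγ _ hm _ ⟨ht0, ht1⟩, abs_of_nonpos (by linarith)]; ring
  · rw [abs_of_nonneg (by linarith)] at hr1 ⊢
    have hm : s - r ∈ Set.Icc 0 l := ⟨by linarith, by linarith⟩
    refine ⟨γ (s - r), ⟨_, hm, rfl⟩, ?_, ?_⟩
    · rw [hγ _ ⟨hs0, hs1⟩ _ hm, abs_of_nonneg (by linarith)]; ring
    · rw [hγ _ hm _ ⟨ht0, ht1⟩, abs_of_nonneg (by linarith)]; ring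

lemma isPreconnected (hS : IsGeodesicSegment S x y) : IsPreconnected S := by
  obtain ⟨l, γ, hl, rfl, rfl, rfl, hγ⟩ := isGeodesicSegment_iff_exists_dist.1 hS
  refine isPreconnected_Icc.image γ (LipschitzOnWith.continuousOn (K := 1) ?_)
  refine LipschitzOnWith.of_dist_le_mul fun s hs t ht => ?_
  rw [hγ s hs t ht, NNReal.coe_one, one_mul, Real.dist_eq]

end IsGeodesicSegment

end Geodesic

/-! ### Hyperbolicity under the collapse of a separating unit segment -/

lemma GeodesicTriangle.thinConstant_le_of_isThin {X Y : Type*} [EMetricSpace X] [EMetricSpace Y]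
    {T : GeodesicTriangle X} {T' : GeodesicTriangle Y} (h : ∀ δ, T'.IsThin δ → T.IsThin δ) :
    T.thinConstant ≤ T'.thinConstant :=
  le_iInf₂ fun δ hδ => iInf₂_le δ (h δ hδ)

/-- `f : X → Y` collapses to the point `o` a segment of length one which separates `X`,
and `h` is the height along that segment, constant on both sides of it. -/
structure IsBridgeCollapse {X Y : Type*} [MetricSpace X] [MetricSpace Y]
    (f : X → Y) (h : X → ℝ) (o : Y) : Prop where
  dist_eq : ∀ p q, dist p q = dist (f p) (f q) + |h p - h q|
  dist_of_ne : ∀ p q, h p ≠ h q → dist (f p) (f q) = dist (f p) o + dist o (f q)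
  surjective : Function.Surjective f
  mem_Icc : ∀ p, h p ∈ Set.Icc (0 : ℝ) 1
  exists_lift : ∀ t ∈ Set.Icc (0 : ℝ) 1, ∃ p, f p = o ∧ h p = t

namespace IsBridgeCollapse

variable {X Y : Type*} [MetricSpace X] [MetricSpace Y] {f : X → Y} {h : X → ℝ} {o : Y}

lemma dist_le (H : IsBridgeCollapse f h o) (p q : X) : dist (f p) (f q) ≤ dist p q := by
  rw [H.dist_eq p q]
  exact le_add_of_nonneg_right (abs_nonneg _)

lemma continuous_map (H : IsBridgeCollapse f h o) : Continuous f :=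
  (LipschitzWith.of_dist_le_mul (K := 1) fun p q => by simpa using H.dist_le p q).continuous

/-- Two triangle inequalities whose sum is an equality are both equalities. -/
lemma dist_add_dist (H : IsBridgeCollapse f h o) {p q r : X} (hq : dist p q + dist q r = dist p r) :
    dist (f p) (f q) + dist (f q) (f r) = dist (f p) (f r) ∧
      |h p - h q| + |h q - h r| = |h p - h r| := by
  rw [H.dist_eq p q, H.dist_eq q r, H.dist_eq p r] at hq
  have h1 := dist_triangle (f p) (f q) (f r)
  have h2 := abs_sub_le (h p) (h q) (h r)
  constructor <;> linarith

lemma height_mem_uIcc (H : IsBridgeCollapse f h o) {S : Set X} {x y p : X}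
    (hS : IsGeodesicSegment S x y) (hp : p ∈ S) : h p ∈ Set.uIcc (h x) (h y) := by
  have := (H.dist_add_dist (hS.dist_add_dist hp)).2
  rw [Set.mem_uIcc]
  grind

/-- The coordinate on the image is the distance to `f x`. It is isometric by additivity, and it
fills the whole interval because the image is connected. -/
lemma isGeodesicSegment_image (H : IsBridgeCollapse f h o) {S : Set X} {x y : X}
    (hS : IsGeodesicSegment S x y) : IsGeodesicSegment (f '' S) (f x) (f y) := by
  have key : ∀ p ∈ S, ∀ q ∈ S, dist x p ≤ dist x q →
      dist (f p) (f q) = |dist (f x) (f p) - dist (f x) (f q)| := by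
    intro p hp q hq hle
    have h1 := hS.dist_eq_abs hp hq
    rw [abs_of_nonpos (by linarith)] at h1
    have h2 := (H.dist_add_dist (p := x) (q := p) (r := q) (by linarith)).1
    rw [abs_of_nonpos (by linarith [dist_nonneg (x := f p) (y := f q)])]
    linarith
  refine isGeodesicSegment_of_coordinate (fun z => dist (f x) z) ⟨x, hS.left_mem, rfl⟩
    ⟨y, hS.right_mem, rfl⟩ (dist_self _) ?_ ?_
  · apply Set.Subset.antisymm
    · rintro _ ⟨_, ⟨p, hp, rfl⟩, rfl⟩
      have := (H.dist_add_dist (hS.dist_add_dist hp)).1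
      exact ⟨dist_nonneg, by linarith [dist_nonneg (x := f p) (y := f y)]⟩
    · have hc : ContinuousOn (fun z => dist (f x) z) (f '' S) := by fun_prop
      have := (hS.isPreconnected.image f H.continuous_map.continuousOn).intermediate_value
        ⟨x, hS.left_mem, rfl⟩ ⟨y, hS.right_mem, rfl⟩ hc
      simpa using this
  · rintro _ ⟨p, hp, rfl⟩ _ ⟨q, hq, rfl⟩
    rcases le_total (dist x p) (dist x q) with hle | hle
    · exact key p hp q hq hle
    · rw [dist_comm, abs_sub_comm]
      exact key q hq p hp hle

/-- A geodesic segment whose ends have different heights contains the collapsed segment. -/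
lemma exists_mem_segment (H : IsBridgeCollapse f h o) {S : Set X} {x y z w : X}
    (hS : IsGeodesicSegment S x y) (hz : z ∈ S) (hw : w ∈ S) (hne : h z ≠ h w) {t : ℝ}
    (ht : t ∈ Set.uIcc (h z) (h w)) : ∃ q ∈ S, f q = o ∧ h q = t := by
  have hzw := H.dist_eq z w
  rw [H.dist_of_ne z w hne] at hzw
  have hbet : |h z - t| + |t - h w| = |h z - h w| := by
    rw [Set.mem_uIcc] at ht
    grind
  have hn1 := dist_nonneg (x := f z) (y := o)
  have hn2 := dist_nonneg (x := o) (y := f w)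
  -- From `z` the geodesic needs length `dist (f z) o` to reach the bridge and then `|h z - t|` to
  -- attain height `t`.
  obtain ⟨q, hq, hq1, hq2⟩ := hS.exists_between hz hw (r := dist (f z) o + |h z - t|)
    ⟨by positivity, by linarith [abs_nonneg (t - h w)]⟩
  have e1 := H.dist_eq z q
  have e2 := H.dist_eq q w
  have hn := dist_nonneg (x := o) (y := f q)
  rw [hq1] at e1
  rw [hq2] at e2
  have c1 := H.dist_of_ne z q
  have c2 := H.dist_of_ne q w
  rw [dist_comm (f q) o] at c2
  -- The height of `q` differs from that of `z` or of `w`, so at least one of `c1`, `c2` applies;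
  -- comparing lengths then forces `dist o (f q) = 0` and `h q = t`.
  refine ⟨q, hq, ?_, ?_⟩
  · rw [eq_comm, ← dist_eq_zero]
    grind
  · grind

lemma hyperbolicityConstant_le (H : IsBridgeCollapse f h o) :
    hyperbolicityConstant X ≤ hyperbolicityConstant Y := by
  have key : ∀ (δ : ℝ≥0) (x₁ x₂ x₃ : X) (S₁₂ S₂₃ S₃₁ : Set X), IsGeodesicSegment S₁₂ x₁ x₂ →
      IsGeodesicSegment S₂₃ x₂ x₃ → IsGeodesicSegment S₃₁ x₃ x₁ →
      WithinNeighborhood δ (f '' S₁₂) (f '' S₂₃ ∪ f '' S₃₁) →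
      WithinNeighborhood δ S₁₂ (S₂₃ ∪ S₃₁) := by
    intro δ x₁ x₂ x₃ S₁₂ S₂₃ S₃₁ h₁₂ h₂₃ h₃₁ hN p hp
    obtain ⟨_, hq, hpq⟩ := hN (f p) ⟨p, hp, rfl⟩
    rw [← Set.image_union] at hq
    obtain ⟨q, hq, rfl⟩ := hq
    rw [edist_nndist, ENNReal.coe_le_coe, ← NNReal.coe_le_coe, coe_nndist] at hpq
    simp only [edist_nndist, ENNReal.coe_le_coe, ← NNReal.coe_le_coe, coe_nndist]
    by_cases hpq' : h p = h q
    · exact ⟨q, hq, by simpa [H.dist_eq p q, hpq'] using hpq⟩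
    -- Such a `q'` has distance `dist (f p) o` to `p`, and this is at most `dist (f p) (f q)`
    -- because `o` separates `f p` from `f q`.
    suffices hex : ∃ q' ∈ S₂₃ ∪ S₃₁, f q' = o ∧ h q' = h p by
      obtain ⟨q', hq', hfq', hhq'⟩ := hex
      refine ⟨q', hq', ?_⟩
      have := H.dist_of_ne p q hpq'
      rw [H.dist_eq p q', hfq', hhq', sub_self, abs_zero, add_zero]
      linarith [dist_nonneg (x := o) (y := f q)]
    -- If `x₃` has the height of `p`, then `q` and `x₃` lie on a common side at different heights.
    -- Otherwise `h p` lies between `h x₃` and the height of `x₁` or `x₂`, and differs from `h x₃`,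
    -- so the corresponding side crosses the bridge at that height.
    by_cases h3 : h x₃ = h p
    · rcases hq with hq | hq
      · obtain ⟨r, hr, hr'⟩ := H.exists_mem_segment h₂₃ hq h₂₃.right_mem (t := h p)
          (by rw [h3]; exact Ne.symm hpq') (by rw [h3]; exact Set.right_mem_uIcc)
        exact ⟨r, Or.inl hr, hr'⟩
      · obtain ⟨r, hr, hr'⟩ := H.exists_mem_segment h₃₁ hq h₃₁.left_mem (t := h p)
          (by rw [h3]; exact Ne.symm hpq') (by rw [h3]; exact Set.right_mem_uIcc)
        exact ⟨r, Or.inr hr, hr'⟩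
    · rcases Set.uIcc_subset_uIcc_union_uIcc (b := h x₃) (H.height_mem_uIcc h₁₂ hp) with hm | hm
      · obtain ⟨r, hr, hr'⟩ := H.exists_mem_segment h₃₁ h₃₁.right_mem h₃₁.left_mem (t := h p)
          (by intro he; rw [he, Set.uIcc_self] at hm; exact h3 hm.symm) hm
        exact ⟨r, Or.inr hr, hr'⟩
      · obtain ⟨r, hr, hr'⟩ := H.exists_mem_segment h₂₃ h₂₃.right_mem h₂₃.left_mem (t := h p)
          (by intro he; rw [← he, Set.uIcc_self] at hm; exact h3 (he.symm ▸ hm.symm)) hm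
        exact ⟨r, Or.inl hr, hr'⟩
  refine iSup_le fun T => ?_
  refine le_trans ?_ (le_iSup _ (⟨f T.x₁, f T.x₂, f T.x₃, f '' T.side₁₂, f '' T.side₂₃,
    f '' T.side₃₁, H.isGeodesicSegment_image T.isGeodesic₁₂,
    H.isGeodesicSegment_image T.isGeodesic₂₃, H.isGeodesicSegment_image T.isGeodesic₃₁⟩ :
    GeodesicTriangle Y))
  refine GeodesicTriangle.thinConstant_le_of_isThin fun δ hδ => ⟨?_, ?_, ?_⟩
  · exact key δ _ _ _ _ _ _ T.isGeodesic₁₂ T.isGeodesic₂₃ T.isGeodesic₃₁ hδ.1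
  · exact key δ _ _ _ _ _ _ T.isGeodesic₂₃ T.isGeodesic₃₁ T.isGeodesic₁₂ hδ.2.1
  · exact key δ _ _ _ _ _ _ T.isGeodesic₃₁ T.isGeodesic₁₂ T.isGeodesic₂₃ hδ.2.2

/-- The lift consists of all points over `S` with height between those of the ends. Its coordinate
is the distance travelled below plus the height gained. -/
lemma exists_lift_isGeodesicSegment_of_le (H : IsBridgeCollapse f h o) {S : Set Y} {p q : X}
    (hS : IsGeodesicSegment S (f p) (f q)) (hpq : h p ≤ h q) :
    ∃ S', IsGeodesicSegment S' p q ∧ f '' S' = S := by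
  have hadd : ∀ y ∈ S, dist (f p) y + dist y (f q) = dist (f p) (f q) :=
    fun y hy => hS.dist_add_dist hy
  -- A preimage at neither end height forces `y = o`, and `o` has a preimage at every height.
  have hlift : ∀ y ∈ S, ∃ z, f z = y ∧ (h z = h p ∨ h z = h q) := by
    intro y hy
    obtain ⟨z, rfl⟩ := H.surjective y
    by_cases hz : h z = h p ∨ h z = h q
    · exact ⟨z, rfl, hz⟩
    · push Not at hz
      have h1 := H.dist_of_ne p z hz.1.symm
      have h2 := H.dist_of_ne z q hz.2
      obtain ⟨m, hm, hmp⟩ := H.exists_lift (h p) (H.mem_Icc p)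
      refine ⟨m, ?_, Or.inl hmp⟩
      rw [hm, ← dist_eq_zero]
      have h3 := hadd _ hy
      have h4 := dist_triangle (f p) o (f q)
      have h5 := dist_comm o (f z)
      linarith [dist_nonneg (x := o) (y := f z)]
  have hiso : ∀ z w, f z ∈ S → h z ∈ Set.Icc (h p) (h q) → f w ∈ S →
      h w ∈ Set.Icc (h p) (h q) → dist (f p) (f z) ≤ dist (f p) (f w) →
      dist z w = |dist (f p) (f z) + (h z - h p) - (dist (f p) (f w) + (h w - h p))| := by
    intro z w hz hz' hw hw' hle
    have h1 := hS.dist_eq_abs hz hw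
    rw [abs_of_nonpos (by linarith)] at h1
    rw [H.dist_eq z w]
    rcases le_or_gt (h z) (h w) with hzw | hzw
    · rw [abs_of_nonpos (a := h z - h w) (by linarith), abs_of_nonpos (by linarith)]
      linarith
    -- If the heights are ordered against the distances below, then `f z` lies no earlier than `o`
    -- and `f w` no later, so the two distances coincide.
    · have h2 := H.dist_of_ne p z (by linarith [hw'.1])
      have h3 := H.dist_of_ne w q (by linarith [hz'.2])
      have h4 := hadd _ hw
      have h5 := dist_triangle (f p) o (f q)
      have h6 := dist_nonneg (x := o) (y := f z)
      have h7 := dist_nonneg (x := f w) (y := o)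
      have h8 : dist (f p) (f z) = dist (f p) (f w) := by linarith
      rw [h1, h8, neg_sub, sub_self, zero_add]
      congr 1
      ring
  refine ⟨{z | f z ∈ S ∧ h z ∈ Set.Icc (h p) (h q)}, ?_, ?_⟩
  · refine isGeodesicSegment_of_coordinate (fun z => dist (f p) (f z) + (h z - h p))
      ⟨hS.left_mem, le_rfl, hpq⟩ ⟨hS.right_mem, hpq, le_rfl⟩ (by simp) ?_ ?_
    · apply Set.Subset.antisymm
      · rintro _ ⟨z, ⟨hz, hz1, hz2⟩, rfl⟩
        have := hadd _ hz
        exact ⟨by simp only; linarith [dist_nonneg (x := f p) (y := f z)],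
          by simp only; linarith [dist_nonneg (x := f z) (y := f q)]⟩
      · rintro t ⟨ht0, ht1⟩
        have hat : ∀ r ∈ Set.Icc 0 (dist (f p) (f q)), ∃ z, f z ∈ S ∧ dist (f p) (f z) = r ∧
            (h z = h p ∨ h z = h q) := by
          intro r hr
          obtain ⟨y, hy, hyr, -⟩ := hS.exists_between hS.left_mem hS.right_mem hr
          obtain ⟨z, rfl, hz⟩ := hlift y hy
          exact ⟨z, hy, hyr, hz⟩
        rcases hpq.eq_or_lt with heq | hlt
        · obtain ⟨z, hz, hzt, hz'⟩ := hat t ⟨ht0, by linarith⟩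
          have : h z = h p := by rcases hz' with h' | h' <;> linarith
          exact ⟨z, ⟨hz, this.ge, this.trans_le hpq⟩, by simp only; linarith⟩
        · have hD := H.dist_of_ne p q hlt.ne
          have hn1 := dist_nonneg (x := f p) (y := o)
          have hn2 := dist_nonneg (x := o) (y := f q)
          have hp0 := (H.mem_Icc p).1
          have hq1 := (H.mem_Icc q).2
          -- The lift stays at height `h p` up to distance `dist (f p) o`, then climbs in the fibre
          -- of `o`, then continues at height `h q`.
          rcases lt_or_ge t (dist (f p) o) with hc | hc
          · obtain ⟨z, hz, hzt, hz'⟩ := hat t ⟨ht0, by linarith⟩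
            have : h z = h p := by
              by_contra hne
              have := H.dist_of_ne p z (Ne.symm hne)
              linarith [dist_nonneg (x := o) (y := f z)]
            exact ⟨z, ⟨hz, this.ge, this.trans_le hpq⟩, by simp only; linarith⟩
          rcases lt_or_ge (dist (f p) o + (h q - h p)) t with hc' | hc'
          · obtain ⟨z, hz, hzt, hz'⟩ := hat (t - (h q - h p)) ⟨by linarith, by linarith⟩
            have : h z = h q := by
              by_contra hne
              have := H.dist_of_ne z q hne
              linarith [dist_nonneg (x := f z) (y := o), hadd _ hz]
            exact ⟨z, ⟨hz, hpq.trans this.ge, this.le⟩, by simp only; linarith⟩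
          · obtain ⟨z, hz, hzt, hz'⟩ := hat (dist (f p) o) ⟨by linarith, by linarith⟩
            have hzo : f z = o := by
              rw [← dist_eq_zero]
              have h1 := hadd _ hz
              have h2 := dist_comm o (f z)
              rcases hz' with h' | h'
              · have := H.dist_of_ne z q (by rw [h']; exact hlt.ne)
                linarith
              · have := H.dist_of_ne p z (by rw [h']; exact hlt.ne)
                linarith
            obtain ⟨m, hm, hmt⟩ := H.exists_lift (h p + (t - dist (f p) o))
              ⟨by linarith, by linarith⟩
            refine ⟨m, ⟨by rw [hm, ← hzo]; exact hz, by linarith, by linarith⟩, ?_⟩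
            simp only
            rw [hm]
            linarith
    · rintro z ⟨hz, hz'⟩ w ⟨hw, hw'⟩
      rcases le_total (dist (f p) (f z)) (dist (f p) (f w)) with hle | hle
      · exact hiso z w hz hz' hw hw' hle
      · rw [dist_comm, abs_sub_comm]
        exact hiso w z hw hw' hz hz' hle
  · apply Set.Subset.antisymm
    · rintro _ ⟨z, hz, rfl⟩
      exact hz.1
    · intro y hy
      obtain ⟨z, rfl, hz | hz⟩ := hlift y hy
      · exact ⟨z, ⟨hy, hz.ge, hz.trans_le hpq⟩, rfl⟩
      · exact ⟨z, ⟨hy, hpq.trans hz.ge, hz.le⟩, rfl⟩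

lemma exists_lift_isGeodesicSegment (H : IsBridgeCollapse f h o) {S : Set Y} {p q : X}
    (hS : IsGeodesicSegment S (f p) (f q)) : ∃ S', IsGeodesicSegment S' p q ∧ f '' S' = S := by
  rcases le_total (h p) (h q) with hpq | hpq
  · exact H.exists_lift_isGeodesicSegment_of_le hS hpq
  · obtain ⟨S', hS', hfS'⟩ := H.exists_lift_isGeodesicSegment_of_le hS.symm hpq
    exact ⟨S', hS'.symm, hfS'⟩

lemma le_hyperbolicityConstant (H : IsBridgeCollapse f h o) :
    hyperbolicityConstant Y ≤ hyperbolicityConstant X := by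
  have key : ∀ (δ : ℝ≥0) (S S' : Set X), WithinNeighborhood δ S S' →
      WithinNeighborhood δ (f '' S) (f '' S') := by
    rintro δ S S' hN _ ⟨p, hp, rfl⟩
    obtain ⟨q, hq, hpq⟩ := hN p hp
    refine ⟨f q, ⟨q, hq, rfl⟩, le_trans ?_ hpq⟩
    rw [edist_dist, edist_dist]
    exact ENNReal.ofReal_le_ofReal (H.dist_le p q)
  refine iSup_le fun ⟨y₁, y₂, y₃, S₁₂, S₂₃, S₃₁, h₁₂, h₂₃, h₃₁⟩ => ?_
  obtain ⟨x₁, rfl⟩ := H.surjective y₁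
  obtain ⟨x₂, rfl⟩ := H.surjective y₂
  obtain ⟨x₃, rfl⟩ := H.surjective y₃
  obtain ⟨L₁₂, g₁₂, rfl⟩ := H.exists_lift_isGeodesicSegment h₁₂
  obtain ⟨L₂₃, g₂₃, rfl⟩ := H.exists_lift_isGeodesicSegment h₂₃
  obtain ⟨L₃₁, g₃₁, rfl⟩ := H.exists_lift_isGeodesicSegment h₃₁
  refine le_trans ?_ (le_iSup _ (⟨x₁, x₂, x₃, L₁₂, L₂₃, L₃₁, g₁₂, g₂₃, g₃₁⟩ : GeodesicTriangle X))
  refine GeodesicTriangle.thinConstant_le_of_isThin fun δ hδ => ⟨?_, ?_, ?_⟩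
  · simpa only [Set.image_union] using key δ _ _ hδ.1
  · simpa only [Set.image_union] using key δ _ _ hδ.2.1
  · simpa only [Set.image_union] using key δ _ _ hδ.2.2

lemma hyperbolicityConstant_eq (H : IsBridgeCollapse f h o) :
    hyperbolicityConstant Y = hyperbolicityConstant X :=
  le_antisymm H.le_hyperbolicityConstant H.hyperbolicityConstant_le

end IsBridgeCollapse

/-! ### Edge parametrization and maximality of the graph distance -/

namespace Graph

variable {α β : Type*}

namespace Point

variable {G : Graph α β}

/-- The point at parameter `t` of the edge `e`, the parameter being clamped to `[0, 1]`. -/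
noncomputable def onEdge (e : G.edgeSet) (t : ℝ) : G.Point :=
  if ht : t ∈ Set.Ioo (0 : ℝ) 1 then inner e ⟨t, ht⟩
  else if t ≤ 0 then vertex (G.src e) else vertex (G.tgt e)

@[simp]
lemma onEdge_zero (e : G.edgeSet) : onEdge e 0 = vertex (G.src e) := by
  simp [onEdge]

@[simp]
lemma onEdge_one (e : G.edgeSet) : onEdge e 1 = vertex (G.tgt e) := by
  simp [onEdge]

lemma onEdge_of_mem (e : G.edgeSet) {t : ℝ} (ht : t ∈ Set.Ioo (0 : ℝ) 1) :
    onEdge e t = inner e ⟨t, ht⟩ := by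
  simp only [onEdge, dif_pos ht]

lemma inner_eq_onEdge (e : G.edgeSet) (t : Set.Ioo (0 : ℝ) 1) : inner e t = onEdge e t :=
  (onEdge_of_mem e t.2).symm

lemma edist_vertex_le (p : G.Point) (v : G.vertexSet) : edist p (vertex v) ≤ toVertex p v :=
  (min_le_right _ _).trans ((iInf_le _ v).trans (by simp [toVertex, vertexDist_self]))

lemma edist_vertex_vertex_le (u v : G.vertexSet) :
    edist (vertex u : G.Point) (vertex v) ≤ G.vertexDist u v :=
  edist_vertex_le _ _

lemma edist_onEdge_le (e : G.edgeSet) {s t : ℝ} (hs : s ∈ Set.Icc (0 : ℝ) 1)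
    (ht : t ∈ Set.Icc (0 : ℝ) 1) :
    edist (onEdge e s) (onEdge e t) ≤ ENNReal.ofReal |s - t| := by
  wlog hst : s ≤ t generalizing s t
  · rw [edist_comm, abs_sub_comm]
    exact this ht hs (le_of_not_ge hst)
  rcases hst.eq_or_lt with rfl | hst
  · simp
  obtain ⟨hs0, hs1⟩ := hs
  obtain ⟨ht0, ht1⟩ := ht
  rcases hs0.eq_or_lt with rfl | hs0
  · rw [onEdge_zero, zero_sub, abs_neg, abs_of_nonneg ht0]
    rcases ht1.eq_or_lt with rfl | ht1
    · rw [onEdge_one, ENNReal.ofReal_one]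
      exact (edist_vertex_vertex_le _ _).trans (vertexDist_src_tgt e)
    · rw [onEdge_of_mem e ⟨hst, ht1⟩, edist_comm]
      refine (edist_vertex_le _ _).trans ((min_le_left _ _).trans ?_)
      simp [vertexDist_self]
  · have hs' : s ∈ Set.Ioo (0 : ℝ) 1 := ⟨hs0, hst.trans_le ht1⟩
    rw [onEdge_of_mem e hs']
    rcases ht1.eq_or_lt with rfl | ht1
    · rw [onEdge_one, abs_of_nonpos (by linarith)]
      refine (edist_vertex_le _ _).trans ((min_le_right _ _).trans ?_)
      simp [vertexDist_self]
    · rw [onEdge_of_mem e ⟨hs0.trans hst, ht1⟩]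
      exact (min_le_left _ _).trans (by simp [alongEdge])

/-- The distance is the largest pseudodistance for which every edge has length at most one. -/
lemma le_edist (F : G.Point → G.Point → ℝ≥0∞) (hself : ∀ p, F p p = 0)
    (hsymm : ∀ p q, F p q = F q p) (htri : ∀ p q r, F p r ≤ F p q + F q r)
    (hedge : ∀ (e : G.edgeSet), ∀ s ∈ Set.Icc (0 : ℝ) 1, ∀ t ∈ Set.Icc (0 : ℝ) 1,
      F (onEdge e s) (onEdge e t) ≤ ENNReal.ofReal |s - t|) (p q : G.Point) :
    F p q ≤ edist p q := by
  have h0 : (0 : ℝ) ∈ Set.Icc (0 : ℝ) 1 := ⟨le_rfl, zero_le_one⟩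
  have h1 : (1 : ℝ) ∈ Set.Icc (0 : ℝ) 1 := ⟨zero_le_one, le_rfl⟩
  have hends : ∀ e : G.edgeSet, F (vertex (G.src e)) (vertex (G.tgt e)) ≤ 1 := by
    intro e
    have := hedge e 0 h0 1 h1
    simpa using this
  have hadj : ∀ u v, G.toSimpleGraph.Adj u v → F (vertex u) (vertex v) ≤ 1 := by
    rintro u v ⟨-, e, he⟩
    have hl := G.isLink_src_tgt ⟨e, he.edge_mem⟩
    have hF := hends ⟨e, he.edge_mem⟩
    rcases he.eq_and_eq_or_eq_and_eq hl with ⟨hu, hv⟩ | ⟨hu, hv⟩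
    · rwa [← Subtype.ext hu, ← Subtype.ext hv] at hF
    · rwa [← Subtype.ext hu, ← Subtype.ext hv, hsymm] at hF
  have hwalk : ∀ u v (w : G.toSimpleGraph.Walk u v), F (vertex u) (vertex v) ≤ w.length := by
    intro u v w
    induction w with
    | nil => simp [hself]
    | cons huv w ih =>
      rw [SimpleGraph.Walk.length_cons, Nat.cast_add, Nat.cast_one, add_comm]
      exact (htri _ _ _).trans (add_le_add (hadj _ _ huv) ih)
  have hvertex : ∀ u v, F (vertex u) (vertex v) ≤ G.vertexDist u v := by
    intro u v
    by_cases huv : G.toSimpleGraph.Reachable u v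
    · obtain ⟨w, hw⟩ := huv.exists_walk_length_eq_edist
      rw [vertexDist, ← hw]
      exact_mod_cast hwalk u v w
    · simp [vertexDist, SimpleGraph.edist_eq_top_of_not_reachable huv]
  have htoVertex : ∀ p v, F p (vertex v) ≤ toVertex p v := by
    intro p v
    cases p with
    | vertex u => exact hvertex u v
    | inner e t =>
      have ht : (t : ℝ) ∈ Set.Icc (0 : ℝ) 1 := Set.Ioo_subset_Icc_self t.2
      have hs := hedge e t ht 0 h0
      have hg := hedge e t ht 1 h1
      rw [sub_zero, abs_of_nonneg ht.1] at hs
      rw [abs_sub_comm, abs_of_nonneg (by linarith [ht.2])] at hg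
      rw [← inner_eq_onEdge] at hs hg
      rw [onEdge_zero] at hs
      rw [onEdge_one] at hg
      exact le_min ((htri _ _ _).trans (add_le_add hs (hvertex _ _)))
        ((htri _ _ _).trans (add_le_add hg (hvertex _ _)))
  refine le_min ?_ (le_iInf fun v => ?_)
  · cases p with
    | vertex u => simp [alongEdge]
    | inner e s =>
      cases q with
      | vertex u => simp [alongEdge]
      | inner f t =>
        by_cases hef : e = f
        · subst hef
          simp only [alongEdge, if_true]
          rw [inner_eq_onEdge, inner_eq_onEdge]
          exact hedge e s (Set.Ioo_subset_Icc_self s.2) t (Set.Ioo_subset_Icc_self t.2)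
        · simp [alongEdge, hef]
  · refine (htri _ (vertex v) _).trans (add_le_add (htoVertex p v) ?_)
    rw [hsymm]
    exact htoVertex q v

end Point

lemma IsConnected.edist_ne_top {G : Graph α β} (hG : G.IsConnected) (p q : G.Point) :
    edist p q ≠ ⊤ := by
  obtain ⟨v⟩ := hG.nonempty
  have hvertex : ∀ u w, G.vertexDist u w ≠ ⊤ := by
    intro u w
    obtain ⟨k, hk⟩ := ENat.ne_top_iff_exists.1
      (SimpleGraph.edist_ne_top_iff_reachable.2 (hG.preconnected u w))
    simp [vertexDist, ← hk]
  have htoVertex : ∀ p : G.Point, p.toVertex v ≠ ⊤ := by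
    intro p
    cases p with
    | vertex u => exact hvertex u v
    | inner e t =>
      exact ((min_le_left _ _).trans_lt
        (ENNReal.add_lt_top.2 ⟨ENNReal.ofReal_lt_top, (hvertex _ _).lt_top⟩)).ne
  exact ((min_le_right _ _).trans_lt ((iInf_le _ v).trans_lt
    (ENNReal.add_lt_top.2 ⟨(htoVertex p).lt_top, (htoVertex q).lt_top⟩))).ne

/-! ### The collapse map onto the contraction -/

section Contraction

variable (G : Graph α β) (e : β)

/-- The image of a vertex in the contraction. -/
def contractVertex (v : G.vertexSet) : (G.contractEdge e).vertexSet :=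
  ⟨Quot.mk _ v, v, v.2, rfl⟩

variable {G e}

lemma surjective_contractVertex : Function.Surjective (G.contractVertex e) := by
  rintro ⟨-, v, hv, rfl⟩
  exact ⟨⟨v, hv⟩, rfl⟩

lemma contractVertex_eq_of_isLink {u v : G.vertexSet} (h : G.IsLink e u v) :
    G.contractVertex e u = G.contractVertex e v :=
  Subtype.ext (Quot.sound h)

lemma eq_or_of_contractVertex_eq {a b : α} (hab : G.IsLink e a b) {u v : G.vertexSet}
    (h : G.contractVertex e u = G.contractVertex e v) :
    u = v ∨ ((u : α) = a ∨ (u : α) = b) ∧ ((v : α) = a ∨ (v : α) = b) := by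
  classical
  -- Sending both ends of `e` to `a` and fixing everything else respects the relation, hence
  -- descends to the quotient and separates the remaining classes.
  have hlift : ∀ x y, G.IsLink e x y →
      (if x = a ∨ x = b then a else x) = if y = a ∨ y = b then a else y := by
    intro x y hxy
    rcases hxy.eq_and_eq_or_eq_and_eq hab with ⟨rfl, rfl⟩ | ⟨rfl, rfl⟩ <;> simp
  have := congrArg (Quot.lift (fun x => if x = a ∨ x = b then a else x) hlift)
    (congrArg Subtype.val h)
  change (if (u : α) = a ∨ (u : α) = b then a else (u : α)) =
    if (v : α) = a ∨ (v : α) = b then a else (v : α) at this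
  rw [Subtype.ext_iff]
  grind

/-- An edge which remains in the contraction. -/
def keptEdge (e' : G.edgeSet) (h : (e' : β) ≠ e) : (G.contractEdge e).edgeSet :=
  ⟨e', e'.2, h⟩

lemma exists_eq_keptEdge (c : (G.contractEdge e).edgeSet) :
    ∃ (e' : G.edgeSet) (h : (e' : β) ≠ e), c = keptEdge e' h :=
  ⟨⟨c, c.2.1⟩, c.2.2, rfl⟩

lemma isLink_keptEdge (e' : G.edgeSet) (h : (e' : β) ≠ e) :
    (G.contractEdge e).IsLink (keptEdge e' h)
      (G.contractVertex e (G.src e')) (G.contractVertex e (G.tgt e')) :=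
  ⟨_, _, ⟨G.isLink_src_tgt e', h⟩, rfl, rfl⟩

open Classical in
/-- The change of parameter from an edge of `G` to the same edge of the contraction, whose ends
may have been ordered the other way. -/
noncomputable def reorient (e' : G.edgeSet) (h : (e' : β) ≠ e) (t : ℝ) : ℝ :=
  if (G.contractEdge e).src (keptEdge e' h) = G.contractVertex e (G.src e') then t else 1 - t

lemma reorient_reorient (e' : G.edgeSet) (h : (e' : β) ≠ e) (t : ℝ) :
    reorient e' h (reorient e' h t) = t := by
  unfold reorient
  split_ifs <;> ring

lemma abs_reorient_sub (e' : G.edgeSet) (h : (e' : β) ≠ e) (s t : ℝ) :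
    |reorient e' h s - reorient e' h t| = |s - t| := by
  unfold reorient
  split_ifs
  · rfl
  · rw [abs_sub_comm]
    congr 1
    ring

lemma reorient_mem_Icc (e' : G.edgeSet) (h : (e' : β) ≠ e) {t : ℝ} (ht : t ∈ Set.Icc (0 : ℝ) 1) :
    reorient e' h t ∈ Set.Icc (0 : ℝ) 1 := by
  unfold reorient
  split_ifs
  · exact ht
  · exact ⟨by linarith [ht.2], by linarith [ht.1]⟩

lemma reorient_mem_Ioo (e' : G.edgeSet) (h : (e' : β) ≠ e) {t : ℝ} (ht : t ∈ Set.Ioo (0 : ℝ) 1) :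
    reorient e' h t ∈ Set.Ioo (0 : ℝ) 1 := by
  unfold reorient
  split_ifs
  · exact ht
  · exact ⟨by linarith [ht.2], by linarith [ht.1]⟩

open Classical in
/-- The map from `G` to `G / e` which collapses the edge `e` to a vertex. -/
noncomputable def collapse (G : Graph α β) (e : β) : G.Point → (G.contractEdge e).Point
  | .vertex v => .vertex (G.contractVertex e v)
  | .inner e' t =>
    if h : (e' : β) = e then .vertex (G.contractVertex e (G.src e'))
    else .onEdge (keptEdge e' h) (reorient e' h t)

lemma collapse_onEdge_of_ne (e' : G.edgeSet) (h : (e' : β) ≠ e) {t : ℝ}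
    (ht : t ∈ Set.Icc (0 : ℝ) 1) :
    collapse G e (.onEdge e' t) = .onEdge (keptEdge e' h) (reorient e' h t) := by
  have hl := (isLink_keptEdge e' h).eq_and_eq_or_eq_and_eq
    ((G.contractEdge e).isLink_src_tgt (keptEdge e' h))
  simp only [← Subtype.ext_iff] at hl
  rcases ht.1.eq_or_lt with rfl | ht0
  · rw [Point.onEdge_zero, collapse, reorient]
    split_ifs with hs
    · rw [Point.onEdge_zero, hs]
    · rw [sub_zero, Point.onEdge_one]
      rcases hl with ⟨hl, -⟩ | ⟨hl, -⟩
      · exact absurd hl.symm hs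
      · rw [hl]
  rcases ht.2.eq_or_lt with rfl | ht1
  · rw [Point.onEdge_one, collapse, reorient]
    split_ifs with hs
    · rw [Point.onEdge_one]
      rcases hl with ⟨-, hl⟩ | ⟨hl, hl'⟩
      · rw [hl]
      -- Here the kept edge is a loop of the contraction, so both orderings of its ends agree.
      · rw [hl', hs, hl]
    · rw [sub_self, Point.onEdge_zero]
      rcases hl with ⟨hl, -⟩ | ⟨-, hl⟩
      · exact absurd hl.symm hs
      · rw [hl]
  · rw [Point.onEdge_of_mem e' ⟨ht0, ht1⟩, collapse, dif_neg h]

lemma collapse_onEdge_self (he : e ∈ G.edgeSet) (t : ℝ) :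
    collapse G e (.onEdge ⟨e, he⟩ t) = .vertex (G.contractVertex e (G.src ⟨e, he⟩)) := by
  unfold Point.onEdge
  split_ifs
  · simp [collapse]
  · rfl
  · exact congrArg Point.vertex (contractVertex_eq_of_isLink (G.isLink_src_tgt ⟨e, he⟩)).symm

lemma onEdge_keptEdge (e' : G.edgeSet) (h : (e' : β) ≠ e) {t : ℝ} (ht : t ∈ Set.Icc (0 : ℝ) 1) :
    Point.onEdge (keptEdge e' h) t = collapse G e (.onEdge e' (reorient e' h t)) := by
  rw [collapse_onEdge_of_ne e' h (reorient_mem_Icc e' h ht), reorient_reorient]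

lemma surjective_collapse : Function.Surjective (collapse G e) := by
  rintro (x | ⟨c, t⟩)
  · obtain ⟨v, rfl⟩ := surjective_contractVertex x
    exact ⟨.vertex v, rfl⟩
  · obtain ⟨e', h, rfl⟩ := exists_eq_keptEdge c
    rw [Point.inner_eq_onEdge, onEdge_keptEdge e' h (Set.Ioo_subset_Icc_self t.2)]
    exact ⟨_, rfl⟩

/-- The collapse is injective outside `e`. -/
lemma eq_or_of_collapse_eq (he : e ∈ G.edgeSet) {p q : G.Point}
    (hpq : collapse G e p = collapse G e q) :
    p = q ∨ (∃ s ∈ Set.Icc (0 : ℝ) 1, p = .onEdge ⟨e, he⟩ s) ∧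
      ∃ t ∈ Set.Icc (0 : ℝ) 1, q = .onEdge ⟨e, he⟩ t := by
  have hend : ∀ v : G.vertexSet, (v : α) = G.src ⟨e, he⟩ ∨ (v : α) = G.tgt ⟨e, he⟩ →
      ∃ t ∈ Set.Icc (0 : ℝ) 1, Point.vertex v = .onEdge ⟨e, he⟩ t := by
    rintro v (hv | hv)
    · exact ⟨0, ⟨le_rfl, zero_le_one⟩, by rw [Point.onEdge_zero, Subtype.ext hv]⟩
    · exact ⟨1, ⟨zero_le_one, le_rfl⟩, by rw [Point.onEdge_one, Subtype.ext hv]⟩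
  have hin : ∀ (e' : G.edgeSet) (t : Set.Ioo (0 : ℝ) 1), (e' : β) = e →
      ∃ s ∈ Set.Icc (0 : ℝ) 1, Point.inner e' t = .onEdge ⟨e, he⟩ s := by
    rintro ⟨_, _⟩ t rfl
    exact ⟨t, Set.Ioo_subset_Icc_self t.2, Point.inner_eq_onEdge _ _⟩
  have hvv : ∀ u v : G.vertexSet, G.contractVertex e u = G.contractVertex e v → u = v ∨
      (∃ s ∈ Set.Icc (0 : ℝ) 1, Point.vertex u = .onEdge ⟨e, he⟩ s) ∧
      ∃ t ∈ Set.Icc (0 : ℝ) 1, Point.vertex v = .onEdge ⟨e, he⟩ t := by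
    intro u v huv
    rcases eq_or_of_contractVertex_eq (G.isLink_src_tgt ⟨e, he⟩) huv with h | ⟨hu, hv⟩
    · exact Or.inl h
    · exact Or.inr ⟨hend u hu, hend v hv⟩
  have hvi : ∀ (u : G.vertexSet) (e' : G.edgeSet) (t : Set.Ioo (0 : ℝ) 1),
      collapse G e (.vertex u) = collapse G e (.inner e' t) →
      (∃ s ∈ Set.Icc (0 : ℝ) 1, Point.vertex u = .onEdge ⟨e, he⟩ s) ∧
      ∃ t' ∈ Set.Icc (0 : ℝ) 1, Point.inner e' t = .onEdge ⟨e, he⟩ t' := by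
    intro u e' t hut
    by_cases h : (e' : β) = e
    · refine ⟨?_, hin e' t h⟩
      have hsrc : e' = ⟨e, he⟩ := Subtype.ext h
      rw [collapse, collapse, dif_pos h, Point.vertex.injEq] at hut
      rcases hvv _ _ hut with h' | h'
      · exact hend u (Or.inl (by rw [h', hsrc]))
      · exact h'.1
    · rw [collapse, collapse, dif_neg h, Point.onEdge_of_mem _ (reorient_mem_Ioo e' h t.2)] at hut
      cases hut
  cases p with
  | vertex u =>
    cases q with
    | vertex v =>
      rw [collapse, collapse, Point.vertex.injEq] at hpq
      exact (hvv u v hpq).imp_left (congrArg _)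
    | inner e' t => exact Or.inr (hvi u e' t hpq)
  | inner e' s =>
    cases q with
    | vertex v => exact Or.inr (hvi v e' s hpq.symm).symm
    | inner e'' t =>
      by_cases h' : (e' : β) = e <;> by_cases h'' : (e'' : β) = e
      · exact Or.inr ⟨hin e' s h', hin e'' t h''⟩
      · rw [collapse, collapse, dif_pos h', dif_neg h'',
          Point.onEdge_of_mem _ (reorient_mem_Ioo e'' h'' t.2)] at hpq
        cases hpq
      · rw [collapse, collapse, dif_neg h', dif_pos h'',
          Point.onEdge_of_mem _ (reorient_mem_Ioo e' h' s.2)] at hpq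
        cases hpq
      · rw [collapse, collapse, dif_neg h', dif_neg h'',
          Point.onEdge_of_mem _ (reorient_mem_Ioo e' h' s.2),
          Point.onEdge_of_mem _ (reorient_mem_Ioo e'' h'' t.2)] at hpq
        injection hpq with h1 h2
        have h3 : e' = e'' := Subtype.ext (congrArg (fun c : (G.contractEdge e).edgeSet => (c : β)) h1)
        subst h3
        have h4 := congrArg (reorient e' h') (congrArg Subtype.val h2)
        simp only [reorient_reorient] at h4
        exact Or.inl (by rw [Subtype.ext h4])

end Contraction

end Graph

/-- Distances in `Y` are bounded by distances in `X`, hence finite, so both spaces become metric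
spaces and `IsBridgeCollapse` applies. -/
lemma hyperbolicityConstant_eq_of_edist {X Y : Type*} [EMetricSpace X] [EMetricSpace Y]
    (hX : ∀ p q : X, edist p q ≠ ⊤) {f : X → Y} {h : X → ℝ} {o : Y}
    (dist_eq : ∀ p q, edist p q = edist (f p) (f q) + ENNReal.ofReal |h p - h q|)
    (dist_of_ne : ∀ p q, h p ≠ h q → edist (f p) (f q) = edist (f p) o + edist o (f q))
    (surjective : Function.Surjective f) (mem_Icc : ∀ p, h p ∈ Set.Icc (0 : ℝ) 1)
    (exists_lift : ∀ t ∈ Set.Icc (0 : ℝ) 1, ∃ p, f p = o ∧ h p = t) :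
    hyperbolicityConstant Y = hyperbolicityConstant X := by
  have hY : ∀ y z : Y, edist y z ≠ ⊤ := by
    intro y z
    obtain ⟨p, rfl⟩ := surjective y
    obtain ⟨q, rfl⟩ := surjective z
    have := hX p q
    rw [dist_eq p q] at this
    exact (ENNReal.add_ne_top.1 this).1
  let _ := EMetricSpace.toMetricSpace hX
  let _ := EMetricSpace.toMetricSpace hY
  refine IsBridgeCollapse.hyperbolicityConstant_eq (f := f) (h := h) (o := o)
    ⟨fun p q => ?_, fun p q hpq => ?_, surjective, mem_Icc, exists_lift⟩
  · change (edist p q).toReal = (edist (f p) (f q)).toReal + _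
    rw [dist_eq p q, ENNReal.toReal_add (hY _ _) ENNReal.ofReal_ne_top,
      ENNReal.toReal_ofReal (abs_nonneg _)]
  · change (edist (f p) (f q)).toReal = (edist (f p) o).toReal + (edist o (f q)).toReal
    rw [dist_of_ne p q hpq, ENNReal.toReal_add (hY _ _) (hY _ _)]

/-! ### Distance formula for a bridge -/

namespace Graph

variable {α β : Type*}

/-- `σ` tells apart the two sides of the bridge `e`. -/
structure IsSideFunction (G : Graph α β) (e : G.edgeSet) (σ : α → ℝ) : Prop where
  eq_zero_or_eq_one : ∀ v, σ v = 0 ∨ σ v = 1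
  src : σ (G.src e) = 0
  tgt : σ (G.tgt e) = 1
  eq_of_isLink : ∀ e' x y, e' ≠ (e : β) → G.IsLink e' x y → σ x = σ y

lemma IsCutEdge.exists_isSideFunction {G : Graph α β} (hG : G.IsConnected) {e : β}
    (he : G.IsCutEdge e) : ∃ σ, G.IsSideFunction ⟨e, he.1⟩ σ := by
  classical
  set a := G.src ⟨e, he.1⟩
  set b := G.tgt ⟨e, he.1⟩
  let H : SimpleGraph G.vertexSet := (G.deleteEdges {e}).toSimpleGraph
  have hadj : ∀ (e' : β) (x y : G.vertexSet), e' ≠ e → G.IsLink e' x y → H.Reachable x y := by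
    intro e' x y hne hl
    by_cases hxy : x = y
    · rw [hxy]
    · exact SimpleGraph.Adj.reachable ⟨hxy, e', hl, hne⟩
  -- Otherwise every passage of a walk through `e` could be rerouted, and `G \ e` would be
  -- connected.
  have hab : ¬ H.Reachable a b := by
    intro hr
    have := hG.nonempty
    refine he.2 (show H.Connected from ⟨fun u v => ?_⟩)
    obtain ⟨w⟩ := hG.preconnected u v
    induction w with
    | nil => rfl
    | @cons u v w huv _ ih =>
      refine SimpleGraph.Reachable.trans ?_ ih
      obtain ⟨-, e', hl⟩ := huv
      by_cases hne : e' = e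
      · subst hne
        rcases hl.eq_and_eq_or_eq_and_eq (G.isLink_src_tgt ⟨e', he.1⟩) with ⟨hu, hv⟩ | ⟨hu, hv⟩
        · rw [Subtype.ext hu, Subtype.ext hv]
          exact hr
        · rw [Subtype.ext hu, Subtype.ext hv]
          exact hr.symm
      · exact hadj e' u v hne hl
  refine ⟨fun v => if ∃ hv : v ∈ G.vertexSet, H.Reachable a ⟨v, hv⟩ then 0 else 1, ?_, ?_, ?_, ?_⟩
  · intro v
    split_ifs <;> simp
  · exact if_pos ⟨a.2, SimpleGraph.Reachable.rfl⟩
  · exact if_neg fun ⟨_, hr⟩ => hab hr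
  · intro e' x y hne hl
    have hr := hadj e' ⟨x, hl.left_mem⟩ ⟨y, hl.right_mem⟩ hne hl
    have : (∃ hv : x ∈ G.vertexSet, H.Reachable a ⟨x, hv⟩) ↔
        ∃ hv : y ∈ G.vertexSet, H.Reachable a ⟨y, hv⟩ :=
      ⟨fun ⟨_, h⟩ => ⟨hl.right_mem, h.trans hr⟩, fun ⟨_, h⟩ => ⟨hl.left_mem, h.trans hr.symm⟩⟩
    simp only [this]

open Classical in
/-- The position along the bridge `e`, extended by the side function `σ`. -/
noncomputable def height {G : Graph α β} (e : β) (σ : α → ℝ) : G.Point → ℝ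
  | .vertex v => σ v
  | .inner e' t => if (e' : β) = e then t else σ (G.src e')

open Classical in
/-- The map which sends the points not at height `k` to the point `z`. -/
noncomputable def retract {G : Graph α β} (e : β) (σ : α → ℝ) (k : ℝ) (z p : G.Point) : G.Point :=
  if height e σ p = k then p else z

namespace IsSideFunction

variable {G : Graph α β} {e : G.edgeSet} {σ : α → ℝ}

lemma height_onEdge_self (H : G.IsSideFunction e σ) {t : ℝ} (ht : t ∈ Set.Icc (0 : ℝ) 1) :
    height (e : β) σ (.onEdge e t) = t := by
  rcases ht.1.eq_or_lt with rfl | ht0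
  · rw [Point.onEdge_zero, height, H.src]
  rcases ht.2.eq_or_lt with rfl | ht1
  · rw [Point.onEdge_one, height, H.tgt]
  · rw [Point.onEdge_of_mem e ⟨ht0, ht1⟩, height, if_pos rfl]

lemma height_onEdge_of_ne (H : G.IsSideFunction e σ) {e' : G.edgeSet} (h : (e' : β) ≠ e) (t : ℝ) :
    height (e : β) σ (.onEdge e' t) = σ (G.src e') := by
  unfold Point.onEdge
  split_ifs
  · rw [height, if_neg h]
  · rfl
  · exact (H.eq_of_isLink _ _ _ h (G.isLink_src_tgt e')).symm

lemma eq_onEdge_or (H : G.IsSideFunction e σ) (p : G.Point) :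
    p = .onEdge e (height (e : β) σ p) ∧ height (e : β) σ p ∈ Set.Icc (0 : ℝ) 1 ∨
      height (e : β) σ p = 0 ∨ height (e : β) σ p = 1 := by
  cases p with
  | vertex v => exact Or.inr (H.eq_zero_or_eq_one v)
  | inner e' t =>
    by_cases h : (e' : β) = e
    · left
      obtain rfl : e' = e := Subtype.ext h
      rw [height, if_pos rfl]
      exact ⟨Point.inner_eq_onEdge _ _, Set.Ioo_subset_Icc_self t.2⟩
    · right
      rw [height, if_neg h]
      exact H.eq_zero_or_eq_one _

lemma height_mem_Icc (H : G.IsSideFunction e σ) (p : G.Point) :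
    height (e : β) σ p ∈ Set.Icc (0 : ℝ) 1 := by
  rcases H.eq_onEdge_or p with ⟨-, h⟩ | h | h
  · exact h
  · rw [h]; exact ⟨le_rfl, zero_le_one⟩
  · rw [h]; exact ⟨zero_le_one, le_rfl⟩

/-- By maximality it suffices to look at single edges: on `e` only the height varies, on any other
edge only the collapsed point does. -/
lemma edist_collapse_add_le (H : G.IsSideFunction e σ) (p q : G.Point) :
    edist (collapse G e p) (collapse G e q) +
      ENNReal.ofReal |height (e : β) σ p - height (e : β) σ q| ≤ edist p q := by
  refine Point.le_edist (fun p q => edist (collapse G e p) (collapse G e q) +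
      ENNReal.ofReal |height (e : β) σ p - height (e : β) σ q|) ?_ ?_ ?_ ?_ p q
  · simp
  · intro p q
    simp only [edist_comm, abs_sub_comm]
  · intro p q r
    calc _ ≤ (edist (collapse G e p) (collapse G e q) + edist (collapse G e q) (collapse G e r)) +
          (ENNReal.ofReal |height (e : β) σ p - height (e : β) σ q| +
            ENNReal.ofReal |height (e : β) σ q - height (e : β) σ r|) := by
          gcongr
          · exact edist_triangle _ _ _
          · rw [← ENNReal.ofReal_add (abs_nonneg _) (abs_nonneg _)]
            exact ENNReal.ofReal_le_ofReal (abs_sub_le _ _ _)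
      _ = _ := by ring
  · intro e' s hs t ht
    by_cases h : (e' : β) = e
    · obtain rfl : e' = e := Subtype.ext h
      simp only [H.height_onEdge_self hs, H.height_onEdge_self ht, collapse_onEdge_self e'.2]
      simp
    · simp only [H.height_onEdge_of_ne h, collapse_onEdge_of_ne e' h hs,
        collapse_onEdge_of_ne e' h ht]
      rw [sub_self, abs_zero, ENNReal.ofReal_zero, add_zero, ← abs_reorient_sub e' h]
      exact Point.edist_onEdge_le _ (reorient_mem_Icc e' h hs) (reorient_mem_Icc e' h ht)

/-- The retraction sends all of `e` to its end at height `k`, so it factors through the collapse. -/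
lemma retract_congr (H : G.IsSideFunction e σ) {k : ℝ} {p q : G.Point}
    (h : collapse G (e : β) p = collapse G e q) :
    retract (e : β) σ k (.onEdge e k) p = retract (e : β) σ k (.onEdge e k) q := by
  rcases eq_or_of_collapse_eq e.2 h with rfl | ⟨⟨s, hs, rfl⟩, ⟨t, ht, rfl⟩⟩
  · rfl
  · simp only [Subtype.coe_eta, retract, H.height_onEdge_self hs, H.height_onEdge_self ht]
    split_ifs with h1 h2 h2 <;> simp [h1, h2]

/-- The contraction embeds into the sum of the two sides of the bridge. -/
lemma edist_retract_add_le (H : G.IsSideFunction e σ) (p q : G.Point) :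
    edist (retract (e : β) σ 0 (.onEdge e 0) p) (retract (e : β) σ 0 (.onEdge e 0) q) +
      edist (retract (e : β) σ 1 (.onEdge e 1) p) (retract (e : β) σ 1 (.onEdge e 1) q) ≤
      edist (collapse G e p) (collapse G e q) := by
  -- By `retract_congr` any section of the collapse serves to define the retractions on the
  -- contraction.
  obtain ⟨s, hs⟩ := (surjective_collapse (G := G) (e := e)).hasRightInverse
  have hret : ∀ k p, retract (e : β) σ k (.onEdge e k) (s (collapse G e p)) =
      retract (e : β) σ k (.onEdge e k) p := fun k p => H.retract_congr (hs _)
  have := Point.le_edist (fun x y =>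
    edist (retract (e : β) σ 0 (.onEdge e 0) (s x)) (retract (e : β) σ 0 (.onEdge e 0) (s y)) +
      edist (retract (e : β) σ 1 (.onEdge e 1) (s x)) (retract (e : β) σ 1 (.onEdge e 1) (s y)))
    ?_ ?_ ?_ ?_ (collapse G e p) (collapse G e q)
  · simpa only [hret] using this
  · simp
  · intro x y
    simp only [edist_comm]
  · intro x y z
    refine (add_le_add (edist_triangle _ (retract (e : β) σ 0 (.onEdge e 0) (s y)) _)
      (edist_triangle _ (retract (e : β) σ 1 (.onEdge e 1) (s y)) _)).trans_eq ?_
    ring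
  · intro c t₁ ht₁ t₂ ht₂
    obtain ⟨e', h, rfl⟩ := exists_eq_keptEdge c
    have hle := Point.edist_onEdge_le e' (reorient_mem_Icc e' h ht₁) (reorient_mem_Icc e' h ht₂)
    rw [abs_reorient_sub] at hle
    simp only [onEdge_keptEdge e' h ht₁, onEdge_keptEdge e' h ht₂, hret]
    simp only [retract, H.height_onEdge_of_ne h]
    -- A kept edge lies on one side: one retraction fixes it and the other is constant on it.
    rcases H.eq_zero_or_eq_one (G.src e') with h' | h' <;> rw [h'] <;> simpa using hle

lemma edist_onEdge_height_le_zero (H : G.IsSideFunction e σ) {p : G.Point}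
    (hp : height (e : β) σ p < 1) : edist p (.onEdge e (height (e : β) σ p)) ≤
      edist (retract (e : β) σ 0 (.onEdge e 0) p) (.onEdge e 0) := by
  rcases H.eq_onEdge_or p with ⟨h, -⟩ | h | h
  · rw [← h, edist_self]
    exact zero_le
  · rw [retract, if_pos h, h]
  · exact absurd h hp.ne

lemma edist_onEdge_height_le_one (H : G.IsSideFunction e σ) {p : G.Point}
    (hp : 0 < height (e : β) σ p) : edist (.onEdge e (height (e : β) σ p)) p ≤
      edist (.onEdge e 1) (retract (e : β) σ 1 (.onEdge e 1) p) := by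
  rcases H.eq_onEdge_or p with ⟨h, -⟩ | h | h
  · rw [← h, edist_self]
    exact zero_le
  · exact absurd h hp.ne'
  · rw [retract, if_pos h, h]

/-- The retraction to side 0 sends `q` to the end of `e` there, and that to side 1 sends `p` to the
other end. So the two summands of `edist_retract_add_le` bound the distances from `p` and `q` to the
bridge. -/
lemma edist_add_edist_le (H : G.IsSideFunction e σ) {p q : G.Point}
    (hpq : height (e : β) σ p < height (e : β) σ q) :
    edist p (.onEdge e (height (e : β) σ p)) + edist (.onEdge e (height (e : β) σ q)) q ≤
      edist (collapse G e p) (collapse G e q) := by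
  have h1 := H.edist_onEdge_height_le_zero (hpq.trans_le (H.height_mem_Icc q).2)
  have h2 := H.edist_onEdge_height_le_one ((H.height_mem_Icc p).1.trans_lt hpq)
  refine (add_le_add h1 h2).trans (le_trans (le_of_eq ?_) (H.edist_retract_add_le p q))
  congr 2
  · rw [retract, if_neg ((H.height_mem_Icc p).1.trans_lt hpq).ne']
  · rw [retract, if_neg (hpq.trans_le (H.height_mem_Icc q).2).ne]

lemma edist_eq (H : G.IsSideFunction e σ) (p q : G.Point) :
    edist p q = edist (collapse G e p) (collapse G e q) +
      ENNReal.ofReal |height (e : β) σ p - height (e : β) σ q| := by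
  refine le_antisymm ?_ (H.edist_collapse_add_le p q)
  wlog hpq : height (e : β) σ p ≤ height (e : β) σ q generalizing p q
  · rw [edist_comm p, edist_comm (collapse G e p), abs_sub_comm]
    exact this q p (le_of_not_ge hpq)
  rcases hpq.eq_or_lt with heq | hlt
  -- At equal heights either both points are the same point of `e`, or one retraction fixes both.
  · have h := H.edist_retract_add_le p q
    refine le_trans ?_ le_self_add
    rcases H.eq_onEdge_or p with ⟨hp, -⟩ | hp | hp
    · rcases H.eq_onEdge_or q with ⟨hq, -⟩ | hq | hq
      · rw [show p = q by rw [hp, hq, heq] , edist_self]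
        exact zero_le
      · rw [retract, retract, if_pos (heq.trans hq), if_pos hq] at h
        exact le_self_add.trans h
      · rw [retract.eq_def _ _ 1, retract.eq_def _ _ 1, if_pos (heq.trans hq), if_pos hq] at h
        exact le_add_self.trans h
    · rw [retract, retract, if_pos hp, if_pos (heq ▸ hp)] at h
      exact le_self_add.trans h
    · rw [retract.eq_def _ _ 1, retract.eq_def _ _ 1, if_pos hp, if_pos (heq ▸ hp)] at h
      exact le_add_self.trans h
  -- At different heights, go from `p` to the bridge, along it, and on to `q`.
  · refine (edist_triangle4 p (.onEdge e (height (e : β) σ p))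
      (.onEdge e (height (e : β) σ q)) q).trans ?_
    rw [add_right_comm]
    exact add_le_add (H.edist_add_edist_le hlt)
      (Point.edist_onEdge_le e (H.height_mem_Icc p) (H.height_mem_Icc q))

/-- The collapse does not increase the distances from `p` and `q` to the bridge, and it sends the
whole bridge to a single vertex. -/
lemma edist_collapse_of_ne (H : G.IsSideFunction e σ) {p q : G.Point}
    (hpq : height (e : β) σ p ≠ height (e : β) σ q) :
    edist (collapse G e p) (collapse G e q) =
      edist (collapse G e p) (.vertex (G.contractVertex e (G.src e))) +
        edist (.vertex (G.contractVertex e (G.src e))) (collapse G e q) := by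
  refine le_antisymm (edist_triangle _ _ _) ?_
  wlog hlt : height (e : β) σ p < height (e : β) σ q generalizing p q
  · rw [add_comm, edist_comm _ (collapse G e q), edist_comm (collapse G e p),
      edist_comm (collapse G e p)]
    exact this hpq.symm (lt_of_le_of_ne (le_of_not_gt hlt) hpq.symm)
  refine le_trans ?_ (H.edist_add_edist_le hlt)
  have hle : ∀ p q : G.Point, edist (collapse G e p) (collapse G e q) ≤ edist p q :=
    fun p q => le_self_add.trans (H.edist_collapse_add_le p q)
  have h1 := hle p (.onEdge e (height (e : β) σ p))
  have h2 := hle (.onEdge e (height (e : β) σ q)) q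
  rw [collapse_onEdge_self e.2] at h1 h2
  exact add_le_add h1 h2

end IsSideFunction

end Graph

theorem theorem4p6 {α β : Type*} (G : Graph α β) (hG : G.IsConnected)
    (e : β) (he : G.IsCutEdge e) :
    hyperbolicityConstant (G.contractEdge e).Point = hyperbolicityConstant G.Point := by
  obtain ⟨σ, H⟩ := he.exists_isSideFunction hG
  exact hyperbolicityConstant_eq_of_edist hG.edist_ne_top H.edist_eq
    (fun _ _ => H.edist_collapse_of_ne) Graph.surjective_collapse H.height_mem_Icc
    fun t ht => ⟨.onEdge ⟨e, he.1⟩ t, Graph.collapse_onEdge_self he.1 t, H.height_onEdge_self ht⟩
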